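/- Let $L$ be a relational language and let $\mathbf K$ be a Fraïssé structure in $L$, i.e. a countably infinite $L$-structure that is ultrahomogeneous (every embedding of a finite substructure of $\mathbf K$ into $\mathbf K$ extends to an automorphism of $\mathbf K$). Let $G=\mathrm{Aut}(\mathbf K)$ and let $\mathbf K=\bigcup_n \mathbf A_n$ with $\mathbf A_0\subseteq \mathbf A_1\subseteq\cdots$ finite substructures. Let $H_n$ be the set of embeddings $\mathbf A_n\to\mathbf K$, on which $G$ acts by $g\cdot x=g\circ x$. The group $G$ acts on the right on the compact space $2^{H_m}$ by $(\chi\cdot g)(f)=\chi(g\cdot f)$; write $\chi_A$ for the characteristic function of $A\subseteq H_m$. A set $S\subseteq H_m$ is *syndetic* if $\chi_\emptyset\notin\overline{\chi_S\cdot G}$, and $P\subseteq H_m$ is *piecewise syndetic* if there is a syndetic $S\subseteq H_m$ with $\chi_S\in\overline{\chi_P\cdot G}$. Let $\beta H_n$ be the set of ultrafilters on $H_n$, and let $S(G)=\varprojlim\beta H_n$ be the inverse limit along the maps $\beta H_n\to\beta H_m$ ($m\le n$) induced by the restriction maps $H_n\to H_m$, $x\mapsto x|_{\mathbf A_m}$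 (this is the Samuel compactification of $G$, where $G$ has the topology of pointwise convergence). For $\alpha\in S(G)$ and $f\in H_m$, let $\alpha\cdot f\in\beta H_m$ be the ultrafilter given by $S\in\alpha\cdot f\iff\{x\in H_n: x\circ f\in S\}\in\alpha(n)$, where $n$ is large enough that $\mathrm{ran}(f)\subseteq\mathbf A_n$ (the choice of $n$ is immaterial). The formula $S\in(\alpha\gamma)(m)\iff\{f\in H_m: S\in\alpha\cdot f\}\in\gamma(m)$, for $m\in\mathbb N$ and $S\subseteq H_m$, makes $S(G)$ a semigroup. A *right ideal* of $S(G)$ is a nonempty $Y\subseteq S(G)$ with $Y\cdot S(G)\subseteq Y$; it is *minimal* if it contains no strictly smaller right ideal. For $P\subseteq H_m$ put $\tilde P=\{\alpha\in S(G):P\in\alpha(m)\}$. **Proposition.** Let $m\in\mathbb N$ and $P\subseteq H_m$. Then $P$ is piecewise syndetic if and only if there are a minimal right ideal $Y\subseteq S(G)$ and some $\alpha\in Y$ with $P\in\alpha(m)$. Equivalently, $P$ is piecewise syndetic if and only if $\tilde P$ meets some minimal right ideal of $S(G)$. -/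

import Mathlib

universe u v w

namespace FraisseDynamics

open FirstOrder FirstOrder.Language

variable {L : FirstOrder.Language.{u, v}} {K : Type w} [L.Structure K]

variable (L K) in
/-- An exhaustion `K = ⋃ₙ Aₙ` of a structure by an increasing sequence of finite substructures. -/
structure Exhaustion where
  /-- The `n`-th finite substructure `Aₙ`. -/
  A : ℕ → L.Substructure K
  finite : ∀ n, (A n : Set K).Finite
  mono : Monotone A
  exhausts : ∀ x : K, ∃ n, x ∈ A n

/-- `Hₙ`, the set of embeddings of `Aₙ` into `K`. -/
abbrev H (E : Exhaustion L K) (n : ℕ) : Type w := E.A n ↪[L] K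

/-- The left action of `Aut(K)` on `Hₘ`: `g · f = g ∘ f`. -/
def autAct {E : Exhaustion L K} {m : ℕ} (g : K ≃[L] K) (f : H E m) : H E m :=
  g.toEmbedding.comp f

/-! ### The right shift on `2^{Hₘ}`; syndetic and piecewise syndetic sets -/

/-- The right shift action: `(χ · g)(f) = χ(g · f)`. -/
def shift {E : Exhaustion L K} {m : ℕ} (χ : H E m → Bool) (g : K ≃[L] K) : H E m → Bool :=
  fun f => χ (autAct g f)

/-- The orbit closure of `χ` in `2^{Hₘ}` (product topology, `Bool` being discrete). -/
def orbitClosure {E : Exhaustion L K} {m : ℕ} (χ : H E m → Bool) : Set (H E m → Bool) :=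
  closure (Set.range fun g : K ≃[L] K => shift χ g)

/-- `S ⊆ Hₘ` is syndetic if the characteristic function of `∅` is not in the orbit closure of
that of `S`. -/
def IsSyndetic {E : Exhaustion L K} {m : ℕ} (S : Set (H E m)) : Prop :=
  (∅ : Set (H E m)).boolIndicator ∉ orbitClosure S.boolIndicator

/-- `P ⊆ Hₘ` is piecewise syndetic if the characteristic function of some syndetic `S` is in the
orbit closure of that of `P`. -/
def IsPiecewiseSyndetic {E : Exhaustion L K} {m : ℕ} (P : Set (H E m)) : Prop :=
  ∃ S : Set (H E m), IsSyndetic S ∧ S.boolIndicator ∈ orbitClosure P.boolIndicator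

/-! ### The Samuel compactification as an inverse limit -/

/-- The map `Hₙ → Hₘ`, `x ↦ x ∘ iₘⁿ`, where `iₘⁿ : Aₘ → Aₙ` is the inclusion. -/
def restr (E : Exhaustion L K) {m n : ℕ} (h : m ≤ n) (x : H E n) : H E m :=
  x.comp (Substructure.inclusion (E.mono h))

/-- `S(G) = lim βHₙ`, the inverse limit of the spaces of ultrafilters on the `Hₙ` along the maps
induced by restriction. -/
def Samuel (E : Exhaustion L K) : Type w :=
  {α : ∀ n, Ultrafilter (H E n) // ∀ (m n : ℕ) (h : m ≤ n), (α n).map (restr E h) = α m}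

/-- The coordinate `α(m) ∈ βHₘ` of `α ∈ S(G)`. -/
def Samuel.at {E : Exhaustion L K} (α : Samuel E) (m : ℕ) : Ultrafilter (H E m) := α.1 m

theorem Samuel.map_at {E : Exhaustion L K} (α : Samuel E) {m n : ℕ} (h : m ≤ n) :
    (α.at n).map (restr E h) = α.at m := α.2 m n h

theorem Samuel.ext {E : Exhaustion L K} {α γ : Samuel E} (h : ∀ m, α.at m = γ.at m) : α = γ :=
  Subtype.ext (funext h)

/-- `x ∘ f` for `x ∈ Hₙ` and `f ∈ Hₘ` with `ran f ⊆ Aₙ`. -/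
def compAt {E : Exhaustion L K} {m n : ℕ} (f : H E m) (hf : ∀ a, f a ∈ E.A n) (x : H E n) :
    H E m :=
  x.comp (f.codRestrict (E.A n) hf)

theorem exists_stage {E : Exhaustion L K} {m : ℕ} (f : H E m) : ∃ n, ∀ a, f a ∈ E.A n := by
  have : Finite (E.A m) := (E.finite m).to_subtype
  choose N hN using fun a => E.exhausts (f a)
  obtain ⟨n, hn⟩ := Finite.exists_le N
  exact ⟨n, fun a => E.mono (hn a) (hN a)⟩

/-- The ultrafilter `α · f ∈ βHₘ` for `α ∈ S(G)` and `f ∈ Hₘ`: a set `S ⊆ Hₘ` belongs to `α · f`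
iff `{x ∈ Hₙ | x ∘ f ∈ S} ∈ α(n)`, where `n` is such that `ran f ⊆ Aₙ`.  By `Samuel.act_eq`
the choice of `n` does not matter. -/
noncomputable def Samuel.act {E : Exhaustion L K} {m : ℕ} (α : Samuel E) (f : H E m) :
    Ultrafilter (H E m) :=
  (α.at (exists_stage f).choose).map (compAt f (exists_stage f).choose_spec)

theorem Samuel.map_compAt_le {E : Exhaustion L K} {m n N : ℕ} (α : Samuel E) (f : H E m)
    (h : n ≤ N) (hf : ∀ a, f a ∈ E.A n) (hf' : ∀ a, f a ∈ E.A N) :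
    (α.at N).map (compAt f hf') = (α.at n).map (compAt f hf) := by
  rw [← α.map_at h, Ultrafilter.map_map]
  rfl

theorem Samuel.act_eq {E : Exhaustion L K} {m n : ℕ} (α : Samuel E) (f : H E m)
    (hf : ∀ a, f a ∈ E.A n) : α.act f = (α.at n).map (compAt f hf) := by
  have hN : ∀ a, f a ∈ E.A (max n (exists_stage f).choose) :=
    fun a => E.mono (le_max_left _ _) (hf a)
  rw [← α.map_compAt_le f (le_max_left _ _) hf hN]
  exact (α.map_compAt_le f (le_max_right _ _) _ hN).symm

theorem Samuel.mem_act_iff {E : Exhaustion L K} {m n : ℕ} (α : Samuel E) (f : H E m)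
    (hf : ∀ a, f a ∈ E.A n) (S : Set (H E m)) :
    S ∈ α.act f ↔ {x : H E n | compAt f hf x ∈ S} ∈ α.at n := by
  rw [α.act_eq f hf]
  exact Ultrafilter.mem_map

theorem Samuel.act_restr {E : Exhaustion L K} {m n : ℕ} (α : Samuel E) (h : m ≤ n) (f : H E n) :
    (α.act f).map (restr E h) = α.act (restr E h f) := by
  obtain ⟨N, hN⟩ := exists_stage f
  rw [α.act_eq f hN, α.act_eq (restr E h f) (n := N) (fun a => hN _), Ultrafilter.map_map]
  rfl

/-- `α⁻¹(S) = {f ∈ Hₘ | S ∈ α · f}`. -/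
def Samuel.returnSet {E : Exhaustion L K} {m : ℕ} (α : Samuel E) (S : Set (H E m)) :
    Set (H E m) :=
  {f | S ∈ α.act f}

theorem mem_bind_iff {X Y : Type*} (p : Ultrafilter X) (F : X → Ultrafilter Y) (S : Set Y) :
    S ∈ p.bind F ↔ {x | S ∈ F x} ∈ p := Iff.rfl

/-- The product of `S(G)`: `S ∈ (αγ)(m) ↔ {f ∈ Hₘ | S ∈ α · f} ∈ γ(m)`. -/
noncomputable instance (E : Exhaustion L K) : Mul (Samuel E) where
  mul α γ := ⟨fun m => (γ.at m).bind fun f => α.act f, by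
    intro m n h
    ext S
    rw [Ultrafilter.mem_map, mem_bind_iff, mem_bind_iff, ← γ.map_at h, Ultrafilter.mem_map]
    have : {x | restr E h ⁻¹' S ∈ α.act x} = restr E h ⁻¹' {f | S ∈ α.act f} := by
      ext f
      rw [Set.mem_preimage, Set.mem_ofPred_eq, Set.mem_ofPred_eq, ← α.act_restr h,
        Ultrafilter.mem_map]
    rw [this]⟩

theorem Samuel.mem_mul_iff {E : Exhaustion L K} {m : ℕ} (α γ : Samuel E) (S : Set (H E m)) :
    S ∈ (α * γ).at m ↔ α.returnSet S ∈ γ.at m := Iff.rfl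

theorem Samuel.act_compAt {E : Exhaustion L K} {m n : ℕ} (α : Samuel E) (f : H E m)
    (hf : ∀ a, f a ∈ E.A n) (y : H E n) :
    α.act (compAt f hf y) = (α.act y).map (compAt f hf) := by
  obtain ⟨N, hN⟩ := exists_stage y
  rw [α.act_eq y hN, α.act_eq (compAt f hf y) (n := N) (fun a => hN _), Ultrafilter.map_map]
  rfl

theorem Samuel.returnSet_mul {E : Exhaustion L K} {m : ℕ} (α γ : Samuel E) (S : Set (H E m)) :
    (α * γ).returnSet S = γ.returnSet (α.returnSet S) := by
  ext f
  obtain ⟨n, hn⟩ := exists_stage f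
  change S ∈ (α * γ).act f ↔ α.returnSet S ∈ γ.act f
  rw [Samuel.mem_act_iff _ f hn, Samuel.mem_act_iff _ f hn, Samuel.mem_mul_iff]
  have : α.returnSet {x : H E n | compAt f hn x ∈ S} =
      {x : H E n | compAt f hn x ∈ α.returnSet S} := by
    ext y
    change _ ∈ α.act y ↔ S ∈ α.act (compAt f hn y)
    rw [α.act_compAt f hn y, Ultrafilter.mem_map]
    rfl
  rw [this]

noncomputable instance (E : Exhaustion L K) : Semigroup (Samuel E) where
  mul_assoc α β γ := by
    apply Samuel.ext
    intro m
    ext S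
    rw [Samuel.mem_mul_iff, Samuel.mem_mul_iff, Samuel.mem_mul_iff, Samuel.returnSet_mul]

/-- `P̃ = {α ∈ S(G) | P ∈ α(m)}`. -/
def tilde {E : Exhaustion L K} {m : ℕ} (P : Set (H E m)) : Set (Samuel E) :=
  {α | P ∈ α.at m}

/-! ### Minimal right ideals -/

/-- A right ideal of a semigroup: a nonempty `Y` with `Y · S ⊆ Y`. -/
def IsRightIdeal {S : Type*} [Semigroup S] (Y : Set S) : Prop :=
  Y.Nonempty ∧ ∀ y ∈ Y, ∀ s : S, y * s ∈ Y

/-- A minimal right ideal: a right ideal containing no strictly smaller right ideal. -/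
def IsMinimalRightIdeal {S : Type*} [Semigroup S] (Y : Set S) : Prop :=
  IsRightIdeal Y ∧ ∀ Z : Set S, IsRightIdeal Z → Z ⊆ Y → Z = Y

end FraisseDynamics

/-! By `mem_orbitClosure_iff`, the orbit closure of the indicator of P consists of the indicators of
the return sets of P. Return sets compose: that of αγ is the γ-return set of the α-return set. So P
is piecewise syndetic iff for some α every αγ has a nonempty return set (`isPiecewiseSyndetic_iff`),
that is, iff every right ideal αγS(G) meets `tilde P`. Compactness puts a minimal right ideal inside
αS(G), which then meets `tilde P`. Conversely, if α lies in a minimal right ideal, then every αγS(G)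
equals that ideal and so contains α. -/

namespace FraisseDynamics

open FirstOrder FirstOrder.Language Filter Topology

/-! ### Minimal right ideals in compact semigroups. -/

section RightIdeals

/-- In a compact Hausdorff semigroup with continuous left translations, every principal right
ideal `s * S` contains a minimal right ideal. -/
theorem exists_isMinimalRightIdeal_subset_range_mul {S : Type*} [Semigroup S]
    [TopologicalSpace S] [CompactSpace S] [T2Space S]
    (hmul : ∀ s : S, Continuous fun t => s * t) (s : S) :
    ∃ Y : Set S, IsMinimalRightIdeal Y ∧ Y ⊆ Set.range fun t => s * t := by
  have hrange : ∀ s : S, IsClosed (Set.range fun t => s * t) ∧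
      IsRightIdeal (Set.range fun t => s * t) := fun s =>
    ⟨(isCompact_range (hmul s)).isClosed, ⟨s * s, s, rfl⟩, by
      rintro _ ⟨t, rfl⟩ r
      exact ⟨t * r, (mul_assoc s t r).symm⟩⟩
  -- Zorn runs over closed right ideals only, so that compactness keeps intersections of chains
  -- nonempty.
  obtain ⟨Y, hY, hmin⟩ := zorn_superset_nonempty {Y : Set S | IsClosed Y ∧ IsRightIdeal Y}
    (fun c hc hchain hne => by
      refine ⟨⋂₀ c, ⟨isClosed_sInter fun t ht => (hc ht).1, ?_, fun y hy r => ?_⟩,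
        fun t ht => Set.sInter_subset_of_mem ht⟩
      · have : Nonempty c := hne.to_subtype
        exact IsCompact.nonempty_sInter_of_directed_nonempty_isCompact_isClosed
          (IsChain.directedOn (r := fun A B : Set S => A ⊇ B) hchain.symm) (fun t ht => (hc ht).2.1)
          (fun t ht => (hc ht).1.isCompact) (fun t ht => (hc ht).1)
      · exact Set.mem_sInter.2 fun t ht => (hc ht).2.2 y (Set.mem_sInter.1 hy t ht) r)
    _ (hrange s)
  refine ⟨Y, ⟨hmin.prop.2, fun Z hZ hZY => hZY.antisymm ?_⟩, hY⟩
  obtain ⟨z, hz⟩ := hZ.1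
  have hzZ : (Set.range fun t => z * t) ⊆ Z := by
    rintro _ ⟨t, rfl⟩
    exact hZ.2 z hz t
  -- Any right ideal Z contains a closed one, `z * S`, so minimality among closed right ideals is
  -- minimality among all.
  exact (hmin.le_of_le (hrange z) (hzZ.trans hZY)).trans hzZ

/-- Every element of a minimal right ideal generates it. -/
theorem IsMinimalRightIdeal.exists_mul_eq {S : Type*} [Semigroup S] {Y : Set S}
    (hY : IsMinimalRightIdeal Y) {y z : S} (hy : y ∈ Y) (hz : z ∈ Y) : ∃ t, y * t = z := by
  have h : (Set.range fun t => y * t) = Y := by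
    refine hY.2 _ ⟨⟨y * y, y, rfl⟩, ?_⟩ ?_
    · rintro _ ⟨t, rfl⟩ r
      exact ⟨t * r, (mul_assoc y t r).symm⟩
    · rintro _ ⟨t, rfl⟩
      exact hY.1.2 y hy t
  exact Set.ext_iff.1 h z |>.2 hz

end RightIdeals

/-! ### The compact Hausdorff topology of S(G). -/

section Topology

theorem continuous_ultrafilter_iff {X Y : Type*} [TopologicalSpace X] {F : X → Ultrafilter Y} :
    Continuous F ↔ ∀ S : Set Y, IsOpen {x | S ∈ F x} := by
  rw [ultrafilterBasis_is_basis.continuous_iff, ultrafilterBasis, Set.forall_mem_range]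
  rfl

variable {L : FirstOrder.Language.{u, v}} {K : Type w} [L.Structure K] {E : Exhaustion L K}

/-- The topology of `S(G)` as a subspace of the product of the `βHₙ`. -/
instance : TopologicalSpace (Samuel E) :=
  inferInstanceAs (TopologicalSpace
    {α : ∀ n, Ultrafilter (H E n) // ∀ (m n : ℕ) (h : m ≤ n), (α n).map (restr E h) = α m})

instance : T2Space (Samuel E) :=
  inferInstanceAs (T2Space
    {α : ∀ n, Ultrafilter (H E n) // ∀ (m n : ℕ) (h : m ≤ n), (α n).map (restr E h) = α m})

instance : CompactSpace (Samuel E) := by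
  have h : IsClosed {α : ∀ n, Ultrafilter (H E n) |
      ∀ (m n : ℕ) (h : m ≤ n), (α n).map (restr E h) = α m} := by
    simp only [Set.ofPred_forall]
    refine isClosed_iInter fun m => isClosed_iInter fun n => isClosed_iInter fun h =>
      isClosed_eq ?_ (continuous_apply m)
    exact continuous_ultrafilter_iff.2 fun S =>
      (ultrafilter_isOpen_basic (restr E h ⁻¹' S)).preimage
        (continuous_apply (A := fun n => Ultrafilter (H E n)) n)
  exact isCompact_iff_compactSpace.1 h.isCompact

theorem Samuel.continuous_at (m : ℕ) : Continuous fun α : Samuel E => α.at m :=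
  (continuous_apply m).comp continuous_subtype_val

theorem Samuel.continuous_mul_left (α : Samuel E) : Continuous fun γ : Samuel E => α * γ := by
  refine Continuous.subtype_mk (continuous_pi fun m => ?_) _
  exact continuous_ultrafilter_iff.2 fun S =>
    (ultrafilter_isOpen_basic (α.returnSet S)).preimage (Samuel.continuous_at m)

end Topology

/-! ### Orbit closures as families of return sets. -/

section OrbitClosure

variable {L : FirstOrder.Language.{u, v}} {K : Type w} [L.Structure K] {E : Exhaustion L K}

/-- The point of `S(G)` that an ultrafilter on `Aut(K)` converges to. -/
def Samuel.ofUltrafilter (U : Ultrafilter (K ≃[L] K)) : Samuel E :=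
  ⟨fun n => U.map fun g => g.toEmbedding.comp (E.A n).subtype, fun m n h => by
    rw [Ultrafilter.map_map]
    rfl⟩

theorem Samuel.mem_act_ofUltrafilter_iff {m : ℕ} (U : Ultrafilter (K ≃[L] K)) (f : H E m)
    (S : Set (H E m)) :
    S ∈ (Samuel.ofUltrafilter U).act f ↔ {g | autAct g f ∈ S} ∈ U := by
  obtain ⟨n, hn⟩ := exists_stage f
  rw [Samuel.mem_act_iff _ f hn]
  rfl

/-- The only point where ultrahomogeneity enters: `E.A n` is finite, hence finitely generated. -/
theorem exists_aut_extending (hK : L.IsUltrahomogeneous K) {n : ℕ} (x : H E n) :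
    ∃ g : K ≃[L] K, x = g.toEmbedding.comp (E.A n).subtype :=
  have : Finite (E.A n) := (E.finite n).to_subtype
  hK (E.A n) Substructure.FG.of_finite x

theorem Samuel.exists_mem_at (hK : L.IsUltrahomogeneous K) {m : ℕ} {T : Set (H E m)}
    (hT : T.Nonempty) : ∃ δ : Samuel E, T ∈ δ.at m := by
  obtain ⟨f, hf⟩ := hT
  obtain ⟨g, rfl⟩ := exists_aut_extending hK f
  exact ⟨Samuel.ofUltrafilter (pure g), hf⟩

theorem boolIndicator_eq_iff {X : Type*} {S T : Set X} {x y : X} :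
    S.boolIndicator x = T.boolIndicator y ↔ (x ∈ S ↔ y ∈ T) := by
  rw [Bool.eq_iff_iff, ← Set.mem_iff_boolIndicator, ← Set.mem_iff_boolIndicator]

/-- The orbit closure of `χ_S` consists of the characteristic functions of the return sets. -/
theorem mem_orbitClosure_iff (hK : L.IsUltrahomogeneous K) {m : ℕ} {S T : Set (H E m)} :
    T.boolIndicator ∈ orbitClosure S.boolIndicator ↔ ∃ α : Samuel E, α.returnSet S = T := by
  constructor
  · intro h
    have : (comap (fun g : K ≃[L] K => shift S.boolIndicator g)
        (𝓝 T.boolIndicator)).NeBot := by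
      rw [comap_neBot_iff_frequently]
      exact mem_closure_iff_frequently.1 h
    -- Along this ultrafilter on the group the shifts of the indicator of S converge to that of T.
    set U := Ultrafilter.of (comap (fun g : K ≃[L] K => shift S.boolIndicator g)
        (𝓝 T.boolIndicator))
    have hU : Tendsto (fun g : K ≃[L] K => shift S.boolIndicator g) U (𝓝 T.boolIndicator) :=
      tendsto_comap.mono_left (Ultrafilter.of_le _)
    refine ⟨Samuel.ofUltrafilter U, Set.ext fun f => ?_⟩
    have hev : ∀ᶠ g in (U : Filter (K ≃[L] K)), autAct g f ∈ S ↔ f ∈ T := by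
      have := tendsto_pi_nhds.1 hU f
      rw [nhds_discrete, tendsto_pure] at this
      exact this.mono fun g hg => boolIndicator_eq_iff.1 hg
    refine (Samuel.mem_act_ofUltrafilter_iff U f S).trans ?_
    exact (eventually_congr hev).trans eventually_const
  · rintro ⟨α, rfl⟩
    refine mem_closure_iff_nhds.2 fun V hV => ?_
    rw [nhds_pi, Filter.mem_pi] at hV
    obtain ⟨I, hI, t, ht, hIt⟩ := hV
    -- One stage contains the ranges of the finitely many f in I, so a single x in `H E n`, extended
    -- to an automorphism, settles all these coordinates at once.
    obtain ⟨n, hn⟩ : ∃ n, ∀ f ∈ I, ∀ a, f a ∈ E.A n := by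
      have := hI.to_subtype
      choose N hN using fun f : I => exists_stage f.1
      obtain ⟨n, hn⟩ := Finite.exists_le N
      exact ⟨n, fun f hf a => E.mono (hn ⟨f, hf⟩) (hN ⟨f, hf⟩ a)⟩
    have hev : ∀ᶠ x in (α.at n : Filter (H E n)),
        ∀ f : I, compAt f.1 (hn f f.2) x ∈ S ↔ f.1 ∈ α.returnSet S := by
      have := hI.to_subtype
      refine eventually_all.2 fun f => ?_
      have hmem := α.mem_act_iff f.1 (hn f f.2) S
      by_cases h : f.1 ∈ α.returnSet S
      · exact mem_of_superset (hmem.1 h) fun x hx => iff_of_true hx h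
      · exact mem_of_superset (Ultrafilter.compl_mem_iff_notMem.2 fun h' => h (hmem.2 h'))
          fun x hx => iff_of_false hx h
    obtain ⟨x, hx⟩ := hev.exists
    obtain ⟨g, rfl⟩ := exists_aut_extending hK x
    refine ⟨shift S.boolIndicator g, hIt fun f hf => ?_, g, rfl⟩
    have : shift S.boolIndicator g f = (α.returnSet S).boolIndicator f :=
      boolIndicator_eq_iff.2 (hx ⟨f, hf⟩)
    rw [this]
    exact mem_of_mem_nhds (ht f)

theorem isSyndetic_iff (hK : L.IsUltrahomogeneous K) {m : ℕ} {S : Set (H E m)} :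
    IsSyndetic S ↔ ∀ α : Samuel E, (α.returnSet S).Nonempty := by
  simp only [IsSyndetic, mem_orbitClosure_iff hK, not_exists, Set.nonempty_iff_ne_empty, ne_eq]

theorem isPiecewiseSyndetic_iff (hK : L.IsUltrahomogeneous K) {m : ℕ} {P : Set (H E m)} :
    IsPiecewiseSyndetic P ↔
      ∃ α : Samuel E, ∀ γ : Samuel E, ((α * γ).returnSet P).Nonempty := by
  simp only [IsPiecewiseSyndetic, mem_orbitClosure_iff hK, isSyndetic_iff hK,
    Samuel.returnSet_mul]
  constructor
  · rintro ⟨_, h, α, rfl⟩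
    exact ⟨α, h⟩
  · rintro ⟨α, h⟩
    exact ⟨_, h, α, rfl⟩

theorem isPiecewiseSyndetic_iff_exists_isMinimalRightIdeal (hK : L.IsUltrahomogeneous K)
    {m : ℕ} {P : Set (H E m)} :
    IsPiecewiseSyndetic P ↔
      ∃ Y : Set (Samuel E), IsMinimalRightIdeal Y ∧ ∃ α ∈ Y, P ∈ α.at m := by
  rw [isPiecewiseSyndetic_iff hK]
  constructor
  · rintro ⟨β, hβ⟩
    obtain ⟨Y, hY, hsub⟩ :=
      exists_isMinimalRightIdeal_subset_range_mul Samuel.continuous_mul_left β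
    obtain ⟨α, hα⟩ := hY.1.1
    obtain ⟨γ, rfl⟩ := hsub hα
    obtain ⟨δ, hδ⟩ := Samuel.exists_mem_at hK (hβ γ)
    exact ⟨Y, hY, _, hY.1.2 _ hα δ, hδ⟩
  · rintro ⟨Y, hY, α, hα, hP⟩
    refine ⟨α, fun γ => ?_⟩
    -- Minimality allows a return from αγ to α; then P ∈ (αγδ)(m) puts the return set of αγ in δ(m),
    -- so it is nonempty.
    obtain ⟨δ, hδ⟩ := hY.exists_mul_eq (hY.1.2 α hα γ) hα
    rw [← hδ, Samuel.mem_mul_iff] at hP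
    exact Ultrafilter.nonempty_of_mem hP

end OrbitClosure

end FraisseDynamics

theorem mainTheorem5 {L : FirstOrder.Language.{u, v}} [L.IsRelational]
    {K : Type w} [L.Structure K] [Countable K] [Infinite K]
    (hK : L.IsUltrahomogeneous K)
    (E : FraisseDynamics.Exhaustion L K) (m : ℕ)
    (P : Set (FraisseDynamics.H E m)) :
    (FraisseDynamics.IsPiecewiseSyndetic P ↔
      ∃ Y : Set (FraisseDynamics.Samuel E), FraisseDynamics.IsMinimalRightIdeal Y ∧
        ∃ α ∈ Y, P ∈ α.at m) ∧
    (FraisseDynamics.IsPiecewiseSyndetic P ↔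
      ∃ Y : Set (FraisseDynamics.Samuel E), FraisseDynamics.IsMinimalRightIdeal Y ∧
        (FraisseDynamics.tilde P ∩ Y).Nonempty) := by
  have h := FraisseDynamics.isPiecewiseSyndetic_iff_exists_isMinimalRightIdeal (E := E) (P := P) hK
  refine ⟨h, h.trans (exists_congr fun Y => and_congr_right fun _ => ?_)⟩
  exact exists_congr fun α => and_comm
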